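/- A two-party XOR game with $m$ questions per party is given by a probability distribution $p$ on $[m]\times[m]$ and a function $f:[m]\times[m]\to\{0,1\}$: on questions $(x,y)$, drawn with probability $p(x,y)$, the players answer with bits $a,b$ and win iff $a\oplus b=f(x,y)$. Its game matrix is $\Phi=\big((-1)^{f(x,y)}p(x,y)\big)_{x,y\in[m]}$, and $\tilde\Phi=\big((-1)^{f(x,y)}\big)_{x,y\in[m]}$ is the non-normalized game matrix. Its exclusivity graph $G$ has the $2m^2$ vertices $(x,y,a)$, $x,y\in[m]$, $a\in\{0,1\}$, where $(x,y,a)$ represents the winning event in which the questions are $x,y$ and the answers are $a$ and $b=a\oplus f(x,y)$. Two vertices $(x,y,a)$ and $(x',y',a')$ are adjacent iff $$(x=x'\text{ and }a\neq a')\quad\text{or}\quad\big(y=y'\text{ and }(-1)^{a\oplus a'}\neq\tilde\Phi_{xy}\tilde\Phi_{x'y'}\big);$$ equivalently, iff one of the players receives the same question in both events but answers differently. For a finite graph $H$, $\alpha(H)$ denotes the independence number and $\Theta(H)=\sup_{n\ge 1}\alpha(H^{n})^{1/n}$ the Shannon capacity, where $H^{n}$ is the $n$-th strong power: its vertices are the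 words of length $n$ over the vertices of $H$, and two distinct words are adjacent iff in each position their letters are equal or adjacent in $H$. Let $\|\cdot\|$ be the spectral norm (the largest singular value). **Theorem.** Let $m\ge 1$ and consider a two-party XOR game with $m$ questions per party, chosen uniformly: $p(x,y)=1/m^2$ for all $x,y$. Suppose that the maximal singular value of $\Phi$ has a pair of (non-normalized) left and right singular vectors with entries $\pm1$, that is, there are $u,v\in\{1,-1\}^m$ with $\Phi v=\|\Phi\|\,u$ and $\Phi^{T}u=\|\Phi\|\,v$. Then $$\Theta(G)=\alpha(G)=\tfrac12\,m\,\big(m+\|\tilde\Phi\|\big).$$ -/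

import Mathlib

/-- The `n`-th strong power of a graph: its vertices are the words of length `n` over the vertices
of `G`, and two distinct words are adjacent iff in every position their letters are equal or
adjacent. -/
def SimpleGraph.strongPow {V : Type*} (G : SimpleGraph V) (n : ℕ) : SimpleGraph (Fin n → V) where
  Adj u v := u ≠ v ∧ ∀ i, u i = v i ∨ G.Adj (u i) (v i)
  symm := ⟨fun _ _ h => ⟨h.1.symm, fun i => (h.2 i).imp Eq.symm fun k => k.symm⟩⟩
  loopless := ⟨fun _ h => h.1 rfl⟩

/-- The Shannon capacity `sup_{n ≥ 1} α(Gⁿ)^(1/n)` of a finite graph, with `Gⁿ` the strong power. -/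
noncomputable def SimpleGraph.shannonCapacity {V : Type*} [Fintype V] (G : SimpleGraph V) : ℝ :=
  ⨆ n : ℕ+, ((G.strongPow n).indepNum : ℝ) ^ (1 / ((n : ℕ) : ℝ))

/-- The supremum that defines the Shannon capacity is over a bounded set. -/
theorem SimpleGraph.bddAbove_shannonCapacity {V : Type*} [Fintype V] (G : SimpleGraph V) :
    BddAbove (Set.range fun n : ℕ+ =>
      ((G.strongPow n).indepNum : ℝ) ^ (1 / ((n : ℕ) : ℝ))) := by
  classical
  refine ⟨Fintype.card V, ?_⟩
  rintro _ ⟨n, rfl⟩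
  obtain ⟨s, hs⟩ := (G.strongPow n).exists_isNIndepSet_indepNum
  have h1 : (G.strongPow n).indepNum ≤ Fintype.card V ^ (n : ℕ) := by
    rw [← hs.card_eq]
    simpa using s.card_le_univ
  have h2 : ((G.strongPow n).indepNum : ℝ) ≤ (Fintype.card V : ℝ) ^ (n : ℕ) := by
    exact_mod_cast h1
  calc ((G.strongPow n).indepNum : ℝ) ^ (1 / ((n : ℕ) : ℝ))
      ≤ ((Fintype.card V : ℝ) ^ (n : ℕ)) ^ (1 / ((n : ℕ) : ℝ)) :=
        Real.rpow_le_rpow (by positivity) h2 (by positivity)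
    _ = Fintype.card V := by
        rw [one_div]
        exact Real.pow_rpow_inv_natCast (by positivity) n.ne_zero

/-- The spectral norm of a real square matrix, that is, its operator norm for the Euclidean norm,
which is its largest singular value. -/
noncomputable def matrixSpectralNorm {m : ℕ} (M : Matrix (Fin m) (Fin m) ℝ) : ℝ :=
  ‖Matrix.toEuclideanCLM (n := Fin m) (𝕜 := ℝ) M‖

/-- `u` and `v` are a left and a right (non-normalized) singular vector that belong together and
belong to the largest singular value of `M`. -/
def IsMaxSingularPair {m : ℕ} (M : Matrix (Fin m) (Fin m) ℝ) (u v : Fin m → ℝ) : Prop :=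
  u ≠ 0 ∧ v ≠ 0 ∧
    M.mulVec v = matrixSpectralNorm M • u ∧ M.transpose.mulVec u = matrixSpectralNorm M • v

/-- A two-party XOR game in which each party has `m` possible questions. The referee draws the
questions `(x, y)` with probability `p x y`, the players answer with bits `a` and `b`, and they win
iff `a ⊕ b = f x y`. -/
structure XorGame (m : ℕ) where
  p : Fin m → Fin m → ℝ
  p_nonneg : ∀ x y, 0 ≤ p x y
  p_sum : ∑ x, ∑ y, p x y = 1
  f : Fin m → Fin m → Bool

namespace XorGame

/-- The questions are uniformly distributed. -/
def IsUniform {m : ℕ} (g : XorGame m) : Prop :=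
  ∀ x y, g.p x y = 1 / (m : ℝ) ^ 2

/-- The game matrix `Φ`, with entries `(-1)^{f(x,y)} p(x,y)`. -/
def gameMatrix {m : ℕ} (g : XorGame m) : Matrix (Fin m) (Fin m) ℝ :=
  Matrix.of fun x y => (-1) ^ (g.f x y).toNat * g.p x y

/-- The non-normalized game matrix `Φ̃`, with entries `(-1)^{f(x,y)}`. -/
def signMatrix {m : ℕ} (g : XorGame m) : Matrix (Fin m) (Fin m) ℝ :=
  Matrix.of fun x y => (-1) ^ (g.f x y).toNat

theorem signMatrix_mul_self {m : ℕ} (g : XorGame m) (x y : Fin m) :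
    g.signMatrix x y * g.signMatrix x y = 1 := by
  cases h : g.f x y <;> simp [signMatrix, h]

/-- The exclusivity graph of the game. The vertex `(x, y, a)` stands for the winning event
`(a, b | x, y)` with `b = a ⊕ f x y`. -/
def graph {m : ℕ} (g : XorGame m) : SimpleGraph (Fin m × Fin m × Bool) where
  Adj v w :=
    (v.1 = w.1 ∧ v.2.2 ≠ w.2.2) ∨
      (v.2.1 = w.2.1 ∧ (-1 : ℝ) ^ (xor v.2.2 w.2.2).toNat ≠
        g.signMatrix v.1 v.2.1 * g.signMatrix w.1 w.2.1)
  symm := ⟨by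
    rintro v w (⟨h1, h2⟩ | ⟨h1, h2⟩)
    · exact Or.inl ⟨h1.symm, h2.symm⟩
    · refine Or.inr ⟨h1.symm, ?_⟩
      rwa [Bool.xor_comm, mul_comm]⟩
  loopless := ⟨by
    rintro v (⟨_, h⟩ | ⟨_, h⟩)
    · exact h rfl
    · simp [signMatrix_mul_self] at h⟩

/-- Adjacency in terms of the events: the events are exclusive iff one of the players gets the same
question in both but answers differently. -/
theorem graph_adj_iff {m : ℕ} (g : XorGame m) (x y x' y' : Fin m) (a b a' b' : Bool)
    (h : xor a b = g.f x y) (h' : xor a' b' = g.f x' y') :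
    g.graph.Adj (x, y, a) (x', y', a') ↔ (x = x' ∧ a ≠ a') ∨ (y = y' ∧ b ≠ b') := by
  simp only [graph, signMatrix, Matrix.of_apply, ← h, ← h']
  cases a <;> cases b <;> cases a' <;> cases b' <;> norm_num

end XorGame

/-!
The upper bound is a dual solution of Lovász's semidefinite program for `ϑ(G)`: a matrix that
dominates the all-ones matrix `J`, vanishes off the diagonal and the edges of `G`, and has diagonal
entries at most `c`. Kronecker powers of such a matrix serve the strong powers of `G` with the
constants `cⁿ`, hence `α(G) ≤ Θ(G) ≤ c`. For the exclusivity graph, let `E_A`, `E_B` and `E_AB` be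
the 0/1 matrices of the relations "same question to Alice", "same question to Bob" and "same
questions to both", and let `D_A`, `D_B` be the diagonal matrices of the answers written as signs.
The matrix is
`(m/2) (E_A - D_A E_A D_A + E_B - D_B E_B D_B) + c D_A E_AB D_A` with `c = m (m + ‖Φ̃‖) / 2`.
By Cauchy-Schwarz `m E_A` and `m E_B` dominate `J`, and the remaining terms are nonnegative because
`o ↦ (row sums of o, column sums of Φ̃ ∘ o)` has squared operator norm at most `m + ‖Φ̃‖`.

For the lower bound, a deterministic strategy given by sign vectors `u`, `v` wins on
`(m² + uᵀ Φ̃ v) / 2` pairwise compatible events, and `uᵀ Φ̃ v = m ‖Φ̃‖` for the singular vectors.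
-/

section

open Matrix
open scoped Kronecker Matrix.Norms.L2Operator

section PosSemidef

variable {V W : Type*}

theorem dotProduct_vecMulVec_mulVec_self [Fintype V] (h F : V → ℝ) :
    F ⬝ᵥ vecMulVec h h *ᵥ F = (h ⬝ᵥ F) ^ 2 := by
  rw [vecMulVec_mulVec, dotProduct_smul, dotProduct_comm F h, sq]
  rfl

variable [Finite V] [Finite W]

theorem posSemidef_vecMulVec_one_one : (vecMulVec 1 1 : Matrix V V ℝ).PosSemidef := by
  simpa using posSemidef_vecMulVec_self_star (1 : V → ℝ)

theorem posSemidef_kronecker_sub_vecMulVec_one {A : Matrix V V ℝ} {B : Matrix W W ℝ}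
    (hA : (A - vecMulVec 1 1).PosSemidef) (hB : (B - vecMulVec 1 1).PosSemidef) :
    (A ⊗ₖ B - vecMulVec 1 1).PosSemidef := by
  have hB' : B.PosSemidef := by simpa using hB.add posSemidef_vecMulVec_one_one
  have hsplit : A ⊗ₖ B - vecMulVec 1 1 =
      (A - vecMulVec 1 1) ⊗ₖ B + vecMulVec 1 1 ⊗ₖ (B - vecMulVec 1 1) := by
    ext i j
    simp only [Matrix.sub_apply, Matrix.add_apply, kroneckerMap_apply, vecMulVec_apply,
      Pi.one_apply]
    ring
  rw [hsplit]
  exact (hA.kronecker hB').add (posSemidef_vecMulVec_one_one.kronecker hB)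

theorem posSemidef_prod_sub_vecMulVec_one {B : Matrix V V ℝ}
    (hB : (B - vecMulVec 1 1).PosSemidef) (n : ℕ) :
    ((of fun u w : Fin n → V => ∏ i, B (u i) (w i)) - vecMulVec 1 1).PosSemidef := by
  induction n with
  | zero =>
    convert PosSemidef.zero using 1
    ext u w
    simp
  | succ n ih =>
    convert (posSemidef_kronecker_sub_vecMulVec_one hB ih).submatrix
      (fun u : Fin (n + 1) → V => (u 0, Fin.tail u)) using 1
    ext u w
    simp [Fin.prod_univ_succ, Fin.tail]

end PosSemidef

section ShannonCapacity

variable {V W : Type*}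

theorem indepNum_le_of_embedding [Finite V] [Finite W] {G : SimpleGraph V} {H : SimpleGraph W}
    (f : G ↪g H) : G.indepNum ≤ H.indepNum := by
  have := Fintype.ofFinite V
  obtain ⟨s, hs⟩ := G.exists_isNIndepSet_indepNum
  have hindep : H.IsIndepSet (s.map f.toEmbedding : Finset W) := by
    rw [Finset.coe_map, SimpleGraph.isIndepSet_iff]
    rintro _ ⟨v, hv, rfl⟩ _ ⟨w, hw, rfl⟩ hne hadj
    exact hs.isIndepSet hv hw (ne_of_apply_ne _ hne) (f.map_adj_iff.1 hadj)
  rw [← hs.card_eq, ← s.card_map f.toEmbedding]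
  exact hindep.card_le_indepNum

/-- A graph is isomorphic to its first strong power, the letters being the words of length one. -/
def strongPowOneIso (G : SimpleGraph V) : G ≃g G.strongPow 1 where
  toEquiv := (Equiv.funUnique (Fin 1) V).symm
  map_rel_iff' {v w} := by
    have hne : G.Adj v w → v ≠ w := G.ne_of_adj
    simp only [SimpleGraph.strongPow, ne_eq, EmbeddingLike.apply_eq_iff_eq]
    simp only [Equiv.funUnique_symm_apply, uniqueElim_const, Fin.forall_fin_one]
    tauto

theorem indepNum_le_shannonCapacity [Fintype V] (G : SimpleGraph V) :
    (G.indepNum : ℝ) ≤ G.shannonCapacity := by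
  refine le_trans ?_ (le_ciSup G.bddAbove_shannonCapacity 1)
  simpa using indepNum_le_of_embedding (strongPowOneIso G).toEmbedding

/-- A feasible point, with value at most `c`, of the semidefinite program dual to the Lovász number
of `G`. The field `nonneg` takes care of the case of an empty `V`. -/
structure IsLovaszCertificate (G : SimpleGraph V) (B : Matrix V V ℝ) (c : ℝ) : Prop where
  nonneg : 0 ≤ c
  posSemidef : (B - vecMulVec 1 1).PosSemidef
  diag_le : ∀ v, B v v ≤ c
  eq_zero : ∀ v w, v ≠ w → ¬ G.Adj v w → B v w = 0

namespace IsLovaszCertificate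

variable {G : SimpleGraph V} {B : Matrix V V ℝ} {c : ℝ}

theorem diag_nonneg (hB : IsLovaszCertificate G B c) (v : V) : 0 ≤ B v v := by
  have h := hB.posSemidef.diag_nonneg (i := v)
  simp only [Matrix.sub_apply, vecMulVec_apply, Pi.one_apply, mul_one] at h
  linarith

theorem sq_sum_le_dotProduct_mulVec [Fintype V] (hB : IsLovaszCertificate G B c) (F : V → ℝ) :
    (∑ v, F v) ^ 2 ≤ F ⬝ᵥ B *ᵥ F := by
  have h := hB.posSemidef.dotProduct_mulVec_nonneg F
  rw [star_trivial, sub_mulVec, dotProduct_sub, dotProduct_vecMulVec_mulVec_self,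
    one_dotProduct] at h
  linarith

theorem indepNum_le [Finite V] (hB : IsLovaszCertificate G B c) : (G.indepNum : ℝ) ≤ c := by
  classical
  have := Fintype.ofFinite V
  obtain ⟨s, hs⟩ := G.exists_isNIndepSet_indepNum
  have hrow : ∀ v ∈ s, ∑ w ∈ s, B v w = B v v := fun v hv =>
    Finset.sum_eq_single_of_mem v hv fun w hw hne =>
      hB.eq_zero v w hne.symm (hs.isIndepSet hv hw hne.symm)
  have hsq : (s.card : ℝ) ^ 2 ≤ s.card * c := calc
    (s.card : ℝ) ^ 2 ≤ ∑ v ∈ s, ∑ w ∈ s, B v w := by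
        simpa [dotProduct, mulVec] using
          hB.sq_sum_le_dotProduct_mulVec fun v => if v ∈ s then 1 else 0
    _ = ∑ v ∈ s, B v v := Finset.sum_congr rfl hrow
    _ ≤ s.card * c := by simpa using s.sum_le_card_nsmul _ c fun v _ => hB.diag_le v
  rw [← hs.card_eq]
  rcases s.card.eq_zero_or_pos with hcard | hcard
  · simpa [hcard] using hB.nonneg
  · rw [sq] at hsq
    exact le_of_mul_le_mul_left hsq (by exact_mod_cast hcard)

theorem strongPow [Finite V] (hB : IsLovaszCertificate G B c) (n : ℕ) :
    IsLovaszCertificate (G.strongPow n) (of fun u w => ∏ i, B (u i) (w i)) (c ^ n) where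
  nonneg := pow_nonneg hB.nonneg n
  posSemidef := posSemidef_prod_sub_vecMulVec_one hB.posSemidef n
  diag_le u := by
    simpa using Finset.prod_le_prod (s := .univ) (fun i _ => hB.diag_nonneg (u i))
      fun i _ => hB.diag_le (u i)
  eq_zero u w hne hadj := by
    obtain ⟨i, hi⟩ : ∃ i, ¬ (u i = w i ∨ G.Adj (u i) (w i)) := by
      by_contra! h
      exact hadj ⟨hne, h⟩
    rw [not_or] at hi
    exact Finset.prod_eq_zero (Finset.mem_univ i) (hB.eq_zero _ _ hi.1 hi.2)

theorem shannonCapacity_le [Fintype V] (hB : IsLovaszCertificate G B c) :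
    G.shannonCapacity ≤ c := by
  refine ciSup_le fun n => ?_
  calc ((G.strongPow n).indepNum : ℝ) ^ (1 / ((n : ℕ) : ℝ))
      ≤ (c ^ (n : ℕ)) ^ (1 / ((n : ℕ) : ℝ)) :=
        Real.rpow_le_rpow (Nat.cast_nonneg _) (hB.strongPow n).indepNum_le (by positivity)
    _ = c := by rw [one_div, Real.pow_rpow_inv_natCast hB.nonneg n.ne_zero]

end IsLovaszCertificate

end ShannonCapacity

section FiberGram

variable {V ι : Type*} [DecidableEq ι]

/-- The Gram matrix of the vectors `h v • e_(π v)`. In terms of the 0/1 matrix `E` of the relation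
`π v = π w` and the diagonal matrix `D` of `h`, it is `D E D`. -/
def fiberGram (π : V → ι) (h : V → ℝ) : Matrix V V ℝ :=
  of fun v w => if π v = π w then h v * h w else 0

theorem isHermitian_fiberGram (π : V → ι) (h : V → ℝ) : (fiberGram π h).IsHermitian :=
  IsHermitian.ext fun v w => by simp [fiberGram, eq_comm, mul_comm]

theorem fiberGram_one_sub_fiberGram_apply_eq_zero {π : V → ι} {h : V → ℝ}
    (hh : ∀ v, h v * h v = 1) {v w : V} (hvw : π v = π w → h v = h w) :
    (fiberGram π 1 - fiberGram π h) v w = 0 := by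
  by_cases hπ : π v = π w
  · simp [fiberGram, hπ, hvw hπ, hh]
  · simp [fiberGram, hπ]

variable [Fintype ι]

theorem dotProduct_fiberGram_mulVec_self [Fintype V] (π : V → ι) (h F : V → ℝ) :
    F ⬝ᵥ fiberGram π h *ᵥ F = ∑ i, (∑ v with π v = i, h v * F v) ^ 2 := by
  have hfiber : ∀ i, (∑ v with π v = i, h v * F v) ^ 2 =
      ∑ v with π v = i, h v * F v * ∑ w with π w = π v, h w * F w := fun i => by
    rw [sq, Finset.sum_mul]
    refine Finset.sum_congr rfl fun v hv => ?_
    rw [(Finset.mem_filter.1 hv).2]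
  simp_rw [hfiber, Finset.sum_fiberwise, dotProduct, mulVec, dotProduct, fiberGram, of_apply,
    Finset.sum_filter, Finset.mul_sum]
  refine Finset.sum_congr rfl fun v _ => Finset.sum_congr rfl fun w _ => ?_
  by_cases hπ : π v = π w
  · rw [if_pos hπ, if_pos hπ.symm]
    ring
  · rw [if_neg hπ, if_neg (Ne.symm hπ), zero_mul, mul_zero, mul_zero]

theorem posSemidef_card_smul_fiberGram_sub_vecMulVec [Finite V] (π : V → ι) (h : V → ℝ) :
    ((Fintype.card ι : ℝ) • fiberGram π h - vecMulVec h h).PosSemidef := by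
  have := Fintype.ofFinite V
  refine .of_dotProduct_mulVec_nonneg ?_ fun F => ?_
  · refine ((isHermitian_fiberGram π h).smul (.all _)).sub (.ext fun v w => ?_)
    simp [vecMulVec_apply, mul_comm]
  · rw [star_trivial, sub_mulVec, smul_mulVec, dotProduct_sub, dotProduct_smul,
      dotProduct_fiberGram_mulVec_self, dotProduct_vecMulVec_mulVec_self, sub_nonneg]
    simpa [Finset.sum_fiberwise, dotProduct] using
      sq_sum_le_card_mul_sum_sq (s := .univ) (f := fun i => ∑ v with π v = i, h v * F v)

end FiberGram

section SpectralNorm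

variable {ι κ : Type*} [Fintype ι] [Fintype κ] [DecidableEq κ]

theorem smul_mulVec_eq_norm_smul_iff {M : Matrix ι κ ℝ} {c : ℝ} (hc : 0 < c) {u : ι → ℝ}
    {v : κ → ℝ} : (c • M) *ᵥ v = ‖c • M‖ • u ↔ M *ᵥ v = ‖M‖ • u := by
  rw [norm_smul, Real.norm_of_nonneg hc.le, smul_mulVec, mul_smul,
    (smul_right_injective _ hc.ne').eq_iff]

theorem two_mul_dotProduct_mulVec_le (M : Matrix ι κ ℝ) (r : ι → ℝ) (q : κ → ℝ) :
    2 * (r ⬝ᵥ M *ᵥ q) ≤ ‖M‖ * (∑ x, r x ^ 2 + ∑ y, q y ^ 2) := by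
  set R : EuclideanSpace ℝ ι := WithLp.toLp 2 r
  set Q : EuclideanSpace ℝ κ := WithLp.toLp 2 q
  have hR : ‖R‖ ^ 2 = ∑ x, r x ^ 2 := EuclideanSpace.real_norm_sq_eq R
  have hQ : ‖Q‖ ^ 2 = ∑ y, q y ^ 2 := EuclideanSpace.real_norm_sq_eq Q
  have hinner : r ⬝ᵥ M *ᵥ q ≤ ‖R‖ * (‖M‖ * ‖Q‖) := calc
    r ⬝ᵥ M *ᵥ q = inner ℝ R (WithLp.toLp 2 (M *ᵥ q)) := by
      rw [EuclideanSpace.inner_toLp_toLp, star_trivial, dotProduct_comm]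
    _ ≤ ‖R‖ * ‖WithLp.toLp 2 (M *ᵥ q)‖ := real_inner_le_norm _ _
    _ ≤ ‖R‖ * (‖M‖ * ‖Q‖) := by gcongr; exact l2_opNorm_mulVec M Q
  have hamgm : ‖M‖ * (2 * ‖R‖ * ‖Q‖) ≤ ‖M‖ * (‖R‖ ^ 2 + ‖Q‖ ^ 2) := by
    gcongr
    exact two_mul_le_add_sq _ _
  rw [← hR, ← hQ]
  linarith

variable [DecidableEq ι] {M : Matrix ι ι ℝ}

theorem sum_sum_add_mul_sq_le (hM : ∀ x y, M x y ^ 2 ≤ 1) (r q : ι → ℝ) :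
    ∑ x, ∑ y, (r x + M x y * q y) ^ 2 ≤
      (Fintype.card ι + ‖M‖) * (∑ x, r x ^ 2 + ∑ y, q y ^ 2) := by
  have hexpand : ∀ x y, (r x + M x y * q y) ^ 2 ≤
      r x ^ 2 + q y ^ 2 + 2 * (r x * (M x y * q y)) := fun x y => by
    nlinarith [mul_le_mul_of_nonneg_right (hM x y) (sq_nonneg (q y))]
  calc ∑ x, ∑ y, (r x + M x y * q y) ^ 2
      ≤ ∑ x, ∑ y, (r x ^ 2 + q y ^ 2 + 2 * (r x * (M x y * q y))) :=
        Finset.sum_le_sum fun x _ => Finset.sum_le_sum fun y _ => hexpand x y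
    _ = Fintype.card ι * (∑ x, r x ^ 2 + ∑ y, q y ^ 2) + 2 * (r ⬝ᵥ M *ᵥ q) := by
        simp only [Finset.sum_add_distrib, Finset.sum_const, Finset.card_univ, nsmul_eq_mul,
          ← Finset.mul_sum, dotProduct, mulVec]
        ring
    _ ≤ (Fintype.card ι + ‖M‖) * (∑ x, r x ^ 2 + ∑ y, q y ^ 2) := by
        linarith [two_mul_dotProduct_mulVec_le M r q]

/- Dual to `sum_sum_add_mul_sq_le`: the two linear maps are adjoint to each other. -/
theorem sum_rowSum_sq_add_sum_colSum_sq_le (hM : ∀ x y, M x y ^ 2 ≤ 1) (o : ι → ι → ℝ) :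
    ∑ x, (∑ y, o x y) ^ 2 + ∑ y, (∑ x, M x y * o x y) ^ 2 ≤
      (Fintype.card ι + ‖M‖) * ∑ x, ∑ y, o x y ^ 2 := by
  set r : ι → ℝ := fun x => ∑ y, o x y
  set q : ι → ℝ := fun y => ∑ x, M x y * o x y
  set N : ℝ := ∑ x, r x ^ 2 + ∑ y, q y ^ 2
  have hadjoint : N = ∑ x, ∑ y, o x y * (r x + M x y * q y) := by
    have hq : ∑ y, q y ^ 2 = ∑ x, ∑ y, o x y * (M x y * q y) := by
      rw [Finset.sum_comm]
      refine Finset.sum_congr rfl fun y _ => ?_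
      rw [sq, Finset.sum_mul]
      exact Finset.sum_congr rfl fun x _ => by ring
    have hr : ∑ x, r x ^ 2 = ∑ x, ∑ y, o x y * r x :=
      Finset.sum_congr rfl fun x _ => by rw [sq, ← Finset.sum_mul]
    simp only [N, hr, hq, mul_add, Finset.sum_add_distrib]
  have hsq : N ^ 2 ≤ (∑ x, ∑ y, o x y ^ 2) * ((Fintype.card ι + ‖M‖) * N) := calc
    N ^ 2 ≤ (∑ x, ∑ y, o x y ^ 2) * ∑ x, ∑ y, (r x + M x y * q y) ^ 2 := by
        rw [hadjoint]
        simp only [← Fintype.sum_prod_type']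
        exact Finset.sum_mul_sq_le_sq_mul_sq _ _ _
    _ ≤ _ := by
        gcongr
        exact sum_sum_add_mul_sq_le hM r q
  have hN : 0 ≤ N := by positivity
  rcases hN.eq_or_lt with hN | hN
  · rw [← hN]
    positivity
  · exact le_of_mul_le_mul_right (by linarith) hN

end SpectralNorm

namespace XorGame

/-- The vertices of the exclusivity graphs: `(x, y, a)` stands for the winning event with questions
`x`, `y` and first answer `a`. -/
abbrev Event (m : ℕ) : Type := Fin m × Fin m × Bool

variable {m : ℕ} (g : XorGame m)

/-- Alice's answer `a` in the event `(x, y, a)`, as the sign `(-1)ᵃ`. -/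
def aliceSign (e : Event m) : ℝ := (-1) ^ e.2.2.toNat

/-- Bob's answer `b = a ⊕ f x y` in the event `(x, y, a)`, as the sign `(-1)ᵇ`. -/
def bobSign (e : Event m) : ℝ := g.signMatrix e.1 e.2.1 * aliceSign e

theorem signMatrix_eq_one_or_neg_one (x y : Fin m) :
    g.signMatrix x y = 1 ∨ g.signMatrix x y = -1 :=
  mul_self_eq_one_iff.1 (g.signMatrix_mul_self x y)

theorem aliceSign_mul_self (e : Event m) : aliceSign e * aliceSign e = 1 := by
  simp [aliceSign, ← mul_pow]

theorem bobSign_mul_self (e : Event m) : g.bobSign e * g.bobSign e = 1 := by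
  rw [bobSign, mul_mul_mul_comm, signMatrix_mul_self, aliceSign_mul_self, one_mul]

theorem aliceSign_eq_aliceSign_iff (e e' : Event m) :
    aliceSign e = aliceSign e' ↔ e.2.2 = e'.2.2 := by
  cases h : e.2.2 <;> cases h' : e'.2.2 <;> norm_num [aliceSign, h, h']

theorem bobSign_eq_bobSign_iff (e e' : Event m) :
    g.bobSign e = g.bobSign e' ↔
      (-1 : ℝ) ^ (xor e.2.2 e'.2.2).toNat =
        g.signMatrix e.1 e.2.1 * g.signMatrix e'.1 e'.2.1 := by
  rcases g.signMatrix_eq_one_or_neg_one e.1 e.2.1 with hs | hs <;>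
    rcases g.signMatrix_eq_one_or_neg_one e'.1 e'.2.1 with hs' | hs' <;>
    cases h : e.2.2 <;> cases h' : e'.2.2 <;> norm_num [bobSign, aliceSign, hs, hs', h, h']

theorem graph_adj_iff_sign_ne (e e' : Event m) :
    g.graph.Adj e e' ↔ (e.1 = e'.1 ∧ aliceSign e ≠ aliceSign e') ∨
      (e.2.1 = e'.2.1 ∧ g.bobSign e ≠ g.bobSign e') := by
  rw [Ne, Ne, aliceSign_eq_aliceSign_iff, bobSign_eq_bobSign_iff]
  rfl

section UpperBound

theorem posSemidef_smul_fiberGram_sub_fiberGram_add_fiberGram :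
    ((m + ‖g.signMatrix‖) • fiberGram (fun e : Event m => (e.1, e.2.1)) aliceSign -
      (fiberGram (fun e : Event m => e.1) aliceSign +
        fiberGram (fun e : Event m => e.2.1) g.bobSign)).PosSemidef := by
  refine .of_dotProduct_mulVec_nonneg ?_ fun F => ?_
  · exact ((isHermitian_fiberGram _ _).smul (.all _)).sub
      ((isHermitian_fiberGram _ _).add (isHermitian_fiberGram _ _))
  let o : Fin m → Fin m → ℝ := fun x y => ∑ a, aliceSign (x, y, a) * F (x, y, a)
  have hAlice : ∀ x, ∑ e with e.1 = x, aliceSign e * F e = ∑ y, o x y := fun x => by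
    rw [Finset.sum_filter, Fintype.sum_prod_type, Fintype.sum_eq_single x fun x' hx => by simp [hx]]
    simp only [Fintype.sum_prod_type, if_true, o]
  have hBob : ∀ y, ∑ e with e.2.1 = y, g.bobSign e * F e = ∑ x, g.signMatrix x y * o x y :=
    fun y => by
      simp only [Finset.sum_filter, Fintype.sum_prod_type, Finset.sum_ite_irrel,
        Finset.sum_const_zero, Finset.sum_ite_eq', Finset.mem_univ, if_true, bobSign, mul_assoc,
        ← Finset.mul_sum, o]
  have hBoth : ∀ x y, ∑ e with (e.1, e.2.1) = (x, y), aliceSign e * F e = o x y := fun x y => by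
    rw [Finset.sum_filter, Fintype.sum_prod_type, Fintype.sum_eq_single x fun x' hx => by simp [hx],
      Fintype.sum_prod_type, Fintype.sum_eq_single y fun y' hy => by simp [hy]]
    simp only [if_true, o]
  have hM : ∀ x y, g.signMatrix x y ^ 2 ≤ 1 := fun x y => by rw [sq, signMatrix_mul_self]
  rw [star_trivial, sub_mulVec, smul_mulVec, add_mulVec, dotProduct_sub, dotProduct_smul,
    dotProduct_add]
  simp only [dotProduct_fiberGram_mulVec_self, Fintype.sum_prod_type, hAlice, hBob, hBoth,
    smul_eq_mul, sub_nonneg]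
  simpa using sum_rowSum_sq_add_sum_colSum_sq_le hM o

/-- The matrix that certifies the upper bound on the Shannon capacity of the exclusivity graph, for
a suitable value `c` of its diagonal entries. -/
noncomputable def thetaMatrix (c : ℝ) : Matrix (Event m) (Event m) ℝ :=
  (m / 2 : ℝ) • ((fiberGram (fun e => e.1) 1 - fiberGram (fun e => e.1) aliceSign) +
    (fiberGram (fun e => e.2.1) 1 - fiberGram (fun e => e.2.1) g.bobSign)) +
  c • fiberGram (fun e => (e.1, e.2.1)) aliceSign

theorem thetaMatrix_apply_of_not_adj (c : ℝ) {e e' : Event m}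
    (hadj : ¬ g.graph.Adj e e') :
    g.thetaMatrix c e e' = c * fiberGram (fun e : Event m => (e.1, e.2.1)) aliceSign e e' := by
  rw [graph_adj_iff_sign_ne] at hadj
  push Not at hadj
  have hAlice := fiberGram_one_sub_fiberGram_apply_eq_zero (π := fun e : Event m => e.1)
    aliceSign_mul_self hadj.1
  have hBob := fiberGram_one_sub_fiberGram_apply_eq_zero (π := fun e : Event m => e.2.1)
    g.bobSign_mul_self hadj.2
  rw [thetaMatrix, Matrix.add_apply, Matrix.smul_apply, Matrix.add_apply, hAlice, hBob,
    Matrix.smul_apply, add_zero, smul_zero, zero_add, smul_eq_mul]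

theorem thetaMatrix_diag (c : ℝ) (e : Event m) : g.thetaMatrix c e e = c := by
  rw [g.thetaMatrix_apply_of_not_adj c (g.graph.irrefl)]
  simp [fiberGram, aliceSign_mul_self]

theorem thetaMatrix_eq_zero (c : ℝ) {e e' : Event m} (hne : e ≠ e')
    (hadj : ¬ g.graph.Adj e e') : g.thetaMatrix c e e' = 0 := by
  have hquestions : (e.1, e.2.1) ≠ (e'.1, e'.2.1) := fun h => by
    obtain ⟨hx, hy⟩ := Prod.mk.inj h
    have hanswer : e.2.2 ≠ e'.2.2 := fun ha => hne (Prod.ext hx (Prod.ext hy ha))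
    exact hadj (Or.inl ⟨hx, hanswer⟩)
  rw [g.thetaMatrix_apply_of_not_adj c hadj, fiberGram, of_apply, if_neg hquestions, mul_zero]

theorem posSemidef_thetaMatrix_sub_vecMulVec_one :
    (g.thetaMatrix (m * (m + ‖g.signMatrix‖) / 2) - vecMulVec 1 1).PosSemidef := by
  have hAlice := posSemidef_card_smul_fiberGram_sub_vecMulVec (fun e : Event m => e.1) 1
  have hBob := posSemidef_card_smul_fiberGram_sub_vecMulVec (fun e : Event m => e.2.1) 1
  have hsigned := g.posSemidef_smul_fiberGram_sub_fiberGram_add_fiberGram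
  rw [Fintype.card_fin] at hAlice hBob
  convert ((hAlice.smul (by norm_num : (0 : ℝ) ≤ 1 / 2)).add
    (hBob.smul (by norm_num : (0 : ℝ) ≤ 1 / 2))).add
    (hsigned.smul (by positivity : (0 : ℝ) ≤ m / 2)) using 1
  unfold thetaMatrix
  module

theorem isLovaszCertificate_thetaMatrix :
    IsLovaszCertificate g.graph (g.thetaMatrix (m * (m + ‖g.signMatrix‖) / 2))
      (m * (m + ‖g.signMatrix‖) / 2) where
  nonneg := by positivity
  posSemidef := g.posSemidef_thetaMatrix_sub_vecMulVec_one
  diag_le e := (g.thetaMatrix_diag _ e).le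
  eq_zero _ _ := g.thetaMatrix_eq_zero _

end UpperBound

section LowerBound

/-- The winning events that occur when the players answer question `x` by `u x` and question `y` by
`v y`, with answers written as signs. -/
noncomputable def strategyEvents (u v : Fin m → ℝ) : Finset (Event m) :=
  {e | aliceSign e = u e.1 ∧ g.bobSign e = v e.2.1}

theorem isIndepSet_strategyEvents (u v : Fin m → ℝ) :
    g.graph.IsIndepSet (g.strategyEvents u v) := by
  intro e he e' he' _ hadj
  simp only [strategyEvents, Finset.coe_filter, Finset.mem_univ, true_and,
    Set.mem_ofPred_eq] at he he'
  rcases (g.graph_adj_iff_sign_ne e e').1 hadj with ⟨hx, ha⟩ | ⟨hy, hb⟩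
  · exact ha (by rw [he.1, he'.1, hx])
  · exact hb (by rw [he.2, he'.2, hy])

variable {u v : Fin m → ℝ}

theorem card_strategyEvents (hu : ∀ x, u x = 1 ∨ u x = -1) (hv : ∀ y, v y = 1 ∨ v y = -1) :
    ((g.strategyEvents u v).card : ℝ) = (m ^ 2 + u ⬝ᵥ g.signMatrix *ᵥ v) / 2 := by
  have hwin : ∀ x y, (∑ a : Bool,
      if aliceSign (x, y, a) = u x ∧ g.bobSign (x, y, a) = v y then (1 : ℝ) else 0) =
        (1 + u x * (g.signMatrix x y * v y)) / 2 := fun x y => by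
    rcases hu x with hux | hux <;> rcases hv y with hvy | hvy <;>
      rcases g.signMatrix_eq_one_or_neg_one x y with hs | hs <;>
      norm_num [Fintype.sum_bool, -Finset.sum_boole, bobSign, aliceSign, hux, hvy, hs]
  simp only [strategyEvents, Finset.card_filter, Nat.cast_sum, Nat.cast_ite, Nat.cast_one,
    Nat.cast_zero, Fintype.sum_prod_type, hwin, ← Finset.sum_div, Finset.sum_add_distrib,
    ← Finset.mul_sum, dotProduct, mulVec]
  simp [sq]

theorem half_mul_add_norm_le_indepNum (hu : ∀ x, u x = 1 ∨ u x = -1)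
    (hv : ∀ y, v y = 1 ∨ v y = -1) (huv : g.signMatrix *ᵥ v = ‖g.signMatrix‖ • u) :
    m * (m + ‖g.signMatrix‖) / 2 ≤ g.graph.indepNum := by
  have huu : u ⬝ᵥ u = m := by
    simp [dotProduct, fun x => mul_self_eq_one_iff.2 (hu x)]
  calc m * (m + ‖g.signMatrix‖) / 2 = (g.strategyEvents u v).card := by
        rw [g.card_strategyEvents hu hv, huv, dotProduct_smul, huu, smul_eq_mul]
        ring
    _ ≤ g.graph.indepNum := by
        exact_mod_cast (g.isIndepSet_strategyEvents u v).card_le_indepNum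

end LowerBound

theorem signMatrix_mulVec_eq_of_isUniform {g : XorGame m} (hunif : g.IsUniform)
    {u v : Fin m → ℝ}
    (huv : g.gameMatrix *ᵥ v = matrixSpectralNorm g.gameMatrix • u) :
    g.signMatrix *ᵥ v = matrixSpectralNorm g.signMatrix • u := by
  rcases m.eq_zero_or_pos with rfl | hm
  · exact Subsingleton.elim _ _
  have hsmul : g.gameMatrix = (1 / (m : ℝ) ^ 2) • g.signMatrix := by
    ext x y
    simp [gameMatrix, signMatrix, hunif x y, mul_comm]
  rw [hsmul] at huv
  exact (smul_mulVec_eq_norm_smul_iff (by positivity)).1 huv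

end XorGame

theorem mainTheorem3_general {m : ℕ} (g : XorGame m)
    (hsing : ∃ u v : Fin m → ℝ, (∀ x, u x = 1 ∨ u x = -1) ∧ (∀ y, v y = 1 ∨ v y = -1) ∧
      g.signMatrix *ᵥ v = matrixSpectralNorm g.signMatrix • u) :
    g.graph.shannonCapacity = (g.graph.indepNum : ℝ) ∧
      (g.graph.indepNum : ℝ) = 1 / 2 * (m : ℝ) * ((m : ℝ) + matrixSpectralNorm g.signMatrix) := by
  obtain ⟨u, v, hu, hv, huv⟩ := hsing
  have hnorm : matrixSpectralNorm g.signMatrix = ‖g.signMatrix‖ := (cstar_norm_def _).symm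
  rw [hnorm] at huv ⊢
  have hlower := g.half_mul_add_norm_le_indepNum hu hv huv
  have hupper := g.isLovaszCertificate_thetaMatrix.shannonCapacity_le
  have hmiddle := indepNum_le_shannonCapacity g.graph
  constructor <;> linarith

end

theorem mainTheorem3 {m : ℕ} (g : XorGame m) (hunif : g.IsUniform)
    (hsing : ∃ u v : Fin m → ℝ, (∀ x, u x = 1 ∨ u x = -1) ∧ (∀ y, v y = 1 ∨ v y = -1) ∧
      IsMaxSingularPair g.gameMatrix u v) :
    g.graph.shannonCapacity = (g.graph.indepNum : ℝ) ∧
      (g.graph.indepNum : ℝ) = 1 / 2 * (m : ℝ) * ((m : ℝ) + matrixSpectralNorm g.signMatrix) := by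
  obtain ⟨u, v, hu, hv, _, _, huv, _⟩ := hsing
  exact mainTheorem3_general g ⟨u, v, hu, hv, XorGame.signMatrix_mulVec_eq_of_isUniform hunif huv⟩
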